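/- Let $k,p\ge1$ be integers. For $w\in\mathbb R^p$ let $\|w\|_0$ be the number of nonzero entries of $w$, let $\mathcal A_k^p=\{a\in\mathbb R^p:\|a\|_0\le k,\ \|a\|_2=1\}$, and let $\theta_k(x)=\inf\{t>0: x\in t\,\mathrm{conv}(\mathcal A_k^p)\}$ be the $k$-support norm. For a norm $\Omega$ on $\mathbb R^p$, the tangent cone of $\Omega$ at $z$ is $T_\Omega(z)=\overline{\bigcup_{\tau>0}\{h:\Omega(z+\tau h)\le\Omega(z)\}}$, and the statistical dimension of $\Omega$ at $z$ is $\mathfrak S(z,\Omega)=\mathbb E\,\|\Pi_{T_\Omega(z)}(G)\|_2^2$, where $G$ is a standard Gaussian vector in $\mathbb R^p$ and $\Pi_{T_\Omega(z)}$ is the orthogonal projection onto $T_\Omega(z)$. (i) Let $w\in\mathbb R^p$ be a vector with at least $k$ nonzero entries that is $s$-sparse, that is, $k\le\|w\|_0\le s\le p$ (in particular, this covers $\|w\|_0=s\ge k$). Let $\tilde w$ be the vector obtained by sorting the entries of $w$ by decreasing absolute value. Then there is a unique integer $r\in\{0,\dots,k-1\}$ with $$|\tilde w_{k-r-1}|>\frac1{r+1}\sum_{i=k-r}^p|\tilde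 w_i|\ \ge\ |\tilde w_{k-r}|\qquad(\text{convention }|\tilde w_0|=\infty),$$ and, with $I_2=\{1,\dots,k-r-1\}$ and $I_1=\{k-r,\dots,s\}$, $$\mathfrak S(w,\theta_k)\le\frac54 s+2\left\{\frac{(r+1)^2\,\|\tilde w_{I_2}\|_2^2}{\|\tilde w_{I_1}\|_1^2}+|I_1|\right\}\log\frac ps .$$ (ii) In particular, for every $a\in\mathcal A_k^p$ with exactly $k$ nonzero entries and strength $\gamma=k\min_{i:\,a_i\ne0}a_i^2$, $$\mathfrak S(a,\theta_k)\le\frac54 k+\frac{2k}{\gamma}\log\frac pk .$$ -/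

import Mathlib

open MeasureTheory ProbabilityTheory Finset

noncomputable section

namespace KSupport

/-- The number `‖w‖₀` of nonzero coordinates of a vector. -/
def nnz {p : ℕ} (w : EuclideanSpace ℝ (Fin p)) : ℕ :=
  Set.ncard {i : Fin p | w i ≠ 0}

/-- The atoms `𝒜_k^p`: unit vectors of `ℝ^p` with at most `k` nonzero coordinates. -/
def atoms (p k : ℕ) : Set (EuclideanSpace ℝ (Fin p)) :=
  {a | nnz a ≤ k ∧ ‖a‖ = 1}

/-- The `k`-support norm `θ_k` on `ℝ^p`, i.e. the atomic norm induced by `𝒜_k^p`: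
`θ_k(x) = inf {t > 0 : x ∈ t • conv 𝒜_k^p}`. -/
def kSupportNorm {p : ℕ} (k : ℕ) (x : EuclideanSpace ℝ (Fin p)) : ℝ :=
  gauge (convexHull ℝ (atoms p k)) x

/-- The strength `k * min_{i ∈ supp a} a_i ^ 2` of an atom. -/
def strength {p : ℕ} (k : ℕ) (a : EuclideanSpace ℝ (Fin p)) : ℝ :=
  k * sInf ((fun i => (a i) ^ 2) '' {i : Fin p | a i ≠ 0})

/-- The tangent cone of `Ω` at `z`: the closure of the cone of descent directions. -/
def tangentCone {E : Type*} [NormedAddCommGroup E] [NormedSpace ℝ E] (Ω : E → ℝ) (z : E) :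
    Set E :=
  closure (⋃ τ ∈ Set.Ioi (0 : ℝ), {h : E | Ω (z + τ • h) ≤ Ω z})

/-- The orthogonal (nearest point) projection of `g` onto the set `K`. -/
def proj {E : Type*} [NormedAddCommGroup E] (K : Set E) (g : E) : E :=
  Classical.epsilon fun u => u ∈ K ∧ ∀ v ∈ K, ‖g - u‖ ≤ ‖g - v‖

/-- Onto a nonempty closed set of a finite dimensional space, `proj` is a nearest point. -/
theorem proj_spec {E : Type*} [NormedAddCommGroup E] [NormedSpace ℝ E] [FiniteDimensional ℝ E]
    {K : Set E} (hK : IsClosed K) (hne : K.Nonempty) (g : E) :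
    proj K g ∈ K ∧ ∀ v ∈ K, ‖g - proj K g‖ ≤ ‖g - v‖ := by
  have : ProperSpace E := FiniteDimensional.proper_real E
  obtain ⟨u, hu, h⟩ := hK.exists_infDist_eq_dist hne g
  refine Classical.epsilon_spec
    (p := fun u => u ∈ K ∧ ∀ v ∈ K, ‖g - u‖ ≤ ‖g - v‖) ⟨u, hu, fun v hv => ?_⟩
  rw [← dist_eq_norm, ← dist_eq_norm, ← h]
  exact Metric.infDist_le_dist_of_mem hv

/-- The statistical dimension `𝔖(z, Ω) = 𝔼 ‖Π_{T_Ω(z)}(G)‖²` of `Ω` at `z ∈ ℝ^p`, where `G` is a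
standard Gaussian vector and `Π` the orthogonal projection. -/
def statisticalDimension {p : ℕ} (z : EuclideanSpace ℝ (Fin p))
    (Ω : EuclideanSpace ℝ (Fin p) → ℝ) : ENNReal :=
  ∫⁻ g, ENNReal.ofReal (‖proj (tangentCone Ω z) g‖ ^ 2)
    ∂(stdGaussian (EuclideanSpace ℝ (Fin p)))

/-- The `i`-th entry, `1 ≤ i ≤ p`, of the vector `w̃` obtained from `w` by sorting its entries by
decreasing absolute values (and `0` for the other `i`). -/
def sortedEntry {p : ℕ} (w : EuclideanSpace ℝ (Fin p)) (i : ℕ) : ℝ :=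
  if h : 1 ≤ i ∧ i ≤ p then w (Tuple.sort (fun j => -|w j|) ⟨i - 1, by omega⟩) else 0

/-- `r ∈ {0, …, k - 1}` satisfies
`|w̃_{k-r-1}| > (1 / (r+1)) ∑_{i=k-r}^p |w̃_i| ≥ |w̃_{k-r}|`, with the convention `|w̃_0| = ∞`. -/
def IsIndex {p : ℕ} (k : ℕ) (w : EuclideanSpace ℝ (Fin p)) (r : ℕ) : Prop :=
  r < k ∧
  (k - r - 1 = 0 ∨
    1 / ((r : ℝ) + 1) * ∑ i ∈ Icc (k - r) p, |sortedEntry w i| < |sortedEntry w (k - r - 1)|) ∧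
  |sortedEntry w (k - r)| ≤ 1 / ((r : ℝ) + 1) * ∑ i ∈ Icc (k - r) p, |sortedEntry w i|

end KSupport

end

namespace KSupport

/-! The projection of `g` onto a cone is no longer than the distance from `g` to any vector of the
polar cone, so it suffices to choose, depending on `g`, a good normal vector at `w`.

Let `B` hold the `k-r-1` largest entries, `m = r+1`, and let `A` be the sum of the other absolute
values divided by `m`. The support function of the atoms is the ℓ²-norm of the `k` largest entries.
Let `y` equal `w` on `B`, have entries at most `A` in absolute value off `B`, and equal `A * sign w`
where `w ≠ 0` there. The support function at `y` is at most `t = √(∑_B w² + m A²)`, while `⟨y, w⟩ =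
t²` and `θ_k(w) ≤ t`; hence `⟨y, h⟩ ≤ 0` for every descent direction `h`
(`inner_nonpos_of_mem_tangentCone`).

Scale `y` by `τ / A` with `τ² = 2 log(p/s)`, and off an `s`-element set `C` containing the support
let the normal vector be `g` clipped to `[-τ, τ]`. The entries in `C` contribute at most `s + τ²
(∑_B w² / A² + |C \ B|)`, and the `p - s` soft-thresholded ones at most `s / 4`
(`tail_constant_le`). For an atom, bounding all nonzero entries below by the smallest gives (ii). -/

/-! ### The `k`-support norm and its dual -/

theorem nnz_le_card {p : ℕ} {w : EuclideanSpace ℝ (Fin p)} {F : Finset (Fin p)}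
    (h : ∀ i, w i ≠ 0 → i ∈ F) : nnz w ≤ #F := by
  rw [nnz, ← Set.ncard_coe_finset]
  exact Set.ncard_le_ncard (fun i hi => h i hi) F.finite_toSet

theorem single_mem_atoms {p k : ℕ} (hk : 1 ≤ k) (i : Fin p) {c : ℝ} (hc : |c| = 1) :
    EuclideanSpace.single i c ∈ atoms p k := by
  refine ⟨(nnz_le_card (F := {i}) fun j hj => ?_).trans (by simpa using hk), by simp [hc]⟩
  by_contra hji
  simp at hji
  simp [hji] at hj

theorem smul_single_mem_convexHull_atoms {p k : ℕ} (hk : 1 ≤ k) (i : Fin p) {c : ℝ}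
    (hc : |c| ≤ 1) : EuclideanSpace.single i c ∈ convexHull ℝ (atoms p k) := by
  have h1 : EuclideanSpace.single i (1 : ℝ) ∈ convexHull ℝ (atoms p k) :=
    subset_convexHull _ _ (single_mem_atoms hk i (by simp))
  have h2 : EuclideanSpace.single i (-1 : ℝ) ∈ convexHull ℝ (atoms p k) :=
    subset_convexHull _ _ (single_mem_atoms hk i (by simp))
  obtain ⟨ha, hb⟩ := abs_le.1 hc
  have := convex_convexHull ℝ (atoms p k) h1 h2 (a := (1 + c) / 2) (b := (1 - c) / 2)
    (by linarith) (by linarith) (by ring)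
  convert this using 1
  ext j
  by_cases hj : j = i
  · subst hj; simp; ring
  · simp [hj]

/-- A point `x` is the average of the vectors `p x_i e_i`, which lie in the hull for small `x`. This
is what makes the gauge well behaved. -/
theorem convexHull_atoms_mem_nhds {p k : ℕ} (hk : 1 ≤ k) (hp : 0 < p) :
    convexHull ℝ (atoms p k) ∈ nhds (0 : EuclideanSpace ℝ (Fin p)) := by
  have hp' : (0 : ℝ) < p := by exact_mod_cast hp
  have hev : ∀ᶠ x : EuclideanSpace ℝ (Fin p) in nhds 0, ∀ i, |(p : ℝ) * x i| < 1 := by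
    rw [Filter.eventually_all]
    intro i
    have : Continuous fun x : EuclideanSpace ℝ (Fin p) => |(p : ℝ) * x i| := by fun_prop
    exact this.continuousAt.eventually_lt continuousAt_const (by simp)
  filter_upwards [hev] with x hx
  have := (convex_convexHull ℝ (atoms p k)).sum_mem (t := univ) (w := fun _ : Fin p => (p : ℝ)⁻¹)
    (z := fun i => EuclideanSpace.single i ((p : ℝ) * x i)) (fun _ _ => by positivity)
    (by simp; field_simp)
    (fun i _ => smul_single_mem_convexHull_atoms hk i (hx i).le)
  convert this using 1
  ext j
  simp [Finset.sum_apply, Pi.single_apply]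
  field_simp

/-- An upper bound on the `k`-support norm from the support function of the atoms. -/
theorem kSupportNorm_le {p k : ℕ} (hk : 1 ≤ k) (hp : 0 < p) {x : EuclideanSpace ℝ (Fin p)} {t : ℝ}
    (ht : 0 < t)
    (h : ∀ y : EuclideanSpace ℝ (Fin p), ∃ a ∈ atoms p k, inner ℝ y x ≤ t * inner ℝ y a) :
    kSupportNorm k x ≤ t := by
  have hC := convexHull_atoms_mem_nhds (p := p) hk hp
  -- Gauge at most `1` means membership in the closed hull; a separating functional would contradict
  -- `h`.
  have hmem : t⁻¹ • x ∈ closure (convexHull ℝ (atoms p k)) := by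
    by_contra hx
    obtain ⟨f, u, hf, hu⟩ := geometric_hahn_banach_closed_point
      (convex_convexHull ℝ (atoms p k)).closure isClosed_closure hx
    obtain ⟨a, ha, hax⟩ := h ((InnerProductSpace.toDual ℝ _).symm f)
    rw [InnerProductSpace.toDual_symm_apply, InnerProductSpace.toDual_symm_apply] at hax
    have h1 := hf a (subset_closure (subset_convexHull _ _ ha))
    rw [map_smul, smul_eq_mul] at hu
    have h2 : t⁻¹ * f x ≤ f a := by
      rw [inv_mul_le_iff₀ ht]; exact hax
    linarith
  rw [← gauge_le_one_iff_mem_closure (convex_convexHull ℝ _) hC,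
    gauge_smul_of_nonneg (by positivity), smul_eq_mul, inv_mul_le_iff₀ ht, mul_one] at hmem
  exact hmem

/-- The bound `M` passes from atoms to their hull. The gauge is an infimum, so the inequality is
proved for every larger `r` and `r` is then sent to the gauge. -/
theorem inner_le_mul_kSupportNorm {p k : ℕ} (hk : 1 ≤ k) (hp : 0 < p)
    {y : EuclideanSpace ℝ (Fin p)} {M : ℝ} (hM : 0 ≤ M) (h : ∀ a ∈ atoms p k, inner ℝ y a ≤ M)
    (x : EuclideanSpace ℝ (Fin p)) : inner ℝ y x ≤ M * kSupportNorm k x := by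
  have hC := convexHull_atoms_mem_nhds (p := p) hk hp
  have hC' : ∀ c ∈ convexHull ℝ (atoms p k), inner ℝ y c ≤ M := by
    intro c hc
    have hconv : Convex ℝ {c : EuclideanSpace ℝ (Fin p) | inner ℝ y c ≤ M} :=
      convex_halfSpace_le (innerSL ℝ y).isLinear M
    exact convexHull_min h hconv hc
  have key : ∀ r, kSupportNorm k x < r → inner ℝ y x ≤ M * r := by
    intro r hr
    obtain ⟨b, hb, hbr, c, hc, rfl⟩ := exists_lt_of_gauge_lt (absorbent_nhds_zero hC) hr
    simp only [inner_smul_right]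
    nlinarith [hC' c hc]
  have hlim : Filter.Tendsto (fun r => M * r) (nhdsWithin (kSupportNorm k x)
      (Set.Ioi (kSupportNorm k x))) (nhds (M * kSupportNorm k x)) :=
    ((continuous_const.mul continuous_id).tendsto _).mono_left nhdsWithin_le_nhds
  exact ge_of_tendsto hlim (by filter_upwards [self_mem_nhdsWithin] with r hr using key r hr)

/-- The support function of the atoms at a vector whose entries exceed `A` only on `B`. -/
theorem inner_atom_le {p k m : ℕ} {B : Finset (Fin p)} (hB : #B + m = k) {A : ℝ} (hA : 0 ≤ A)
    {y : EuclideanSpace ℝ (Fin p)} (hy : ∀ i ∈ B, A ≤ |y i|) (hy' : ∀ i ∉ B, |y i| ≤ A)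
    {a : EuclideanSpace ℝ (Fin p)} (ha : a ∈ atoms p k) :
    inner ℝ y a ≤ √(∑ i ∈ B, y i ^ 2 + m * A ^ 2) := by
  classical
  obtain ⟨hcard, hnorm⟩ := ha
  set F : Finset (Fin p) := univ.filter fun i => a i ≠ 0 with hF
  have hFk : #F ≤ k := by
    rw [nnz, ← Set.ncard_coe_finset F] at *
    simpa [hF] using hcard
  have hna : ∑ i, a i ^ 2 = 1 := by
    have := EuclideanSpace.real_norm_sq_eq a
    rw [hnorm] at this; linarith
  have h1 : inner ℝ y a = ∑ i ∈ F, y i * a i := by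
    rw [PiLp.inner_apply, hF, Finset.sum_filter]
    refine Finset.sum_congr rfl fun i _ => ?_
    by_cases h : a i = 0 <;> simp [h, mul_comm]
  have h2 : (∑ i ∈ F, y i * a i) ^ 2 ≤ (∑ i ∈ F, y i ^ 2) * 1 := by
    refine (Finset.sum_mul_sq_le_sq_mul_sq F _ _).trans
      (mul_le_mul_of_nonneg_left ?_ (Finset.sum_nonneg fun i _ => sq_nonneg _))
    rw [← hna]
    exact Finset.sum_le_univ_sum_of_nonneg fun i => sq_nonneg _
  -- The summand is nonnegative on `B` and nonpositive off it, so `B` maximizes the sum over all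
  -- index sets.
  have h3 : ∑ i ∈ F, (y i ^ 2 - A ^ 2) ≤ ∑ i ∈ B, (y i ^ 2 - A ^ 2) := by
    rw [← Finset.sum_filter_add_sum_filter_not F (· ∈ B)]
    have e1 : ∑ i ∈ F with i ∈ B, (y i ^ 2 - A ^ 2) ≤ ∑ i ∈ B, (y i ^ 2 - A ^ 2) := by
      refine Finset.sum_le_sum_of_subset_of_nonneg (fun i hi => (Finset.mem_filter.1 hi).2)
        fun i hi _ => ?_
      have := pow_le_pow_left₀ hA (hy i hi) 2
      rw [sq_abs] at this; linarith
    have e2 : ∑ i ∈ F with i ∉ B, (y i ^ 2 - A ^ 2) ≤ 0 := by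
      refine Finset.sum_nonpos fun i hi => ?_
      have := pow_le_pow_left₀ (abs_nonneg _) (hy' i (Finset.mem_filter.1 hi).2) 2
      rw [sq_abs] at this; linarith
    linarith
  simp only [Finset.sum_sub_distrib, Finset.sum_const, nsmul_eq_mul] at h3
  have h4 : (#F : ℝ) * A ^ 2 ≤ (#B + m) * A ^ 2 := by
    refine mul_le_mul_of_nonneg_right ?_ (sq_nonneg _)
    exact_mod_cast hFk.trans hB.ge
  rw [h1]
  exact Real.le_sqrt_of_sq_le (by linarith)

/-- The top-`m` weighted sum dominates any sum with weights in `[0, A]` and total weight `m A`. -/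
theorem exists_card_eq_sum_mul_le {ι : Type*} [DecidableEq ι] (D : Finset ι) (m : ℕ) (hm : m ≤ #D)
    (u v : ι → ℝ) {A : ℝ} (hu : ∀ i ∈ D, 0 ≤ u i) (huA : ∀ i ∈ D, u i ≤ A)
    (hsum : ∑ i ∈ D, u i ≤ m * A) (hv : ∀ i ∈ D, 0 ≤ v i) :
    ∃ J ⊆ D, #J = m ∧ ∑ i ∈ D, u i * v i ≤ A * ∑ i ∈ J, v i := by
  -- `J` collects `m` largest values of `v`, and `c` is a threshold separating them from the rest.
  obtain ⟨J, hJD, hJm, c, hc0, hcJ, hcD⟩ : ∃ J ⊆ D, #J = m ∧ ∃ c : ℝ, 0 ≤ c ∧ (∀ i ∈ J, c ≤ v i) ∧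
      ∀ i ∈ D \ J, v i ≤ c := by
    clear hsum
    induction m with
    | zero =>
      exact ⟨∅, by simp, by simp, ∑ i ∈ D, v i, Finset.sum_nonneg hv, by simp,
        fun i hi => Finset.single_le_sum hv (Finset.mem_sdiff.1 hi).1⟩
    | succ m ih =>
      obtain ⟨J, hJD, hJm, c, hc0, hcJ, hcD⟩ := ih (by omega)
      have hne : (D \ J).Nonempty := by
        rw [← Finset.card_pos, Finset.card_sdiff_of_subset hJD]; omega
      obtain ⟨j, hj, hmax⟩ := Finset.exists_max_image (D \ J) v hne
      have hj' := Finset.mem_sdiff.1 hj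
      refine ⟨insert j J, Finset.insert_subset hj'.1 hJD, by rw [Finset.card_insert_of_notMem hj'.2,
        hJm], v j, hv j hj'.1, ?_, ?_⟩
      · intro i hi
        rcases Finset.mem_insert.1 hi with rfl | hi
        · exact le_rfl
        · exact (hcD j hj).trans (hcJ i hi)
      · intro i hi
        simp only [Finset.mem_sdiff, Finset.mem_insert, not_or] at hi
        exact hmax i (Finset.mem_sdiff.2 ⟨hi.1, hi.2.2⟩)
  refine ⟨J, hJD, hJm, ?_⟩
  -- The mass of `u` on `D \ J` is at most `∑_J (A - u)`, the room left on `J`, and moving it across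
  -- the threshold `c` only increases the sum.
  have e1 : ∑ i ∈ D \ J, u i * v i ≤ ∑ i ∈ D \ J, u i * c :=
    Finset.sum_le_sum fun i hi =>
      mul_le_mul_of_nonneg_left (hcD i hi) (hu i (Finset.mem_sdiff.1 hi).1)
  have e2 : ∑ i ∈ J, (A - u i) * c ≤ ∑ i ∈ J, (A - u i) * v i :=
    Finset.sum_le_sum fun i hi =>
      mul_le_mul_of_nonneg_left (hcJ i hi) (sub_nonneg.2 (huA i (hJD hi)))
  rw [← Finset.sum_sdiff hJD] at hsum ⊢
  rw [← Finset.sum_mul] at e1 e2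
  simp only [sub_mul, Finset.sum_sub_distrib, Finset.sum_const, hJm, nsmul_eq_mul,
    ← Finset.mul_sum] at e2
  nlinarith

/-- The explicit upper bound on the `k`-support norm. -/
theorem kSupportNorm_le_sqrt {p k m : ℕ} (hk : 1 ≤ k) (hm : 1 ≤ m) (hp : k ≤ p)
    {B : Finset (Fin p)} (hB : #B + m = k) {A : ℝ} (hA : 0 < A) {w : EuclideanSpace ℝ (Fin p)}
    (hw' : ∀ i ∉ B, |w i| ≤ A) (hsum : ∑ i ∈ Bᶜ, |w i| = m * A) :
    kSupportNorm k w ≤ √(∑ i ∈ B, w i ^ 2 + m * A ^ 2) := by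
  classical
  have hm' : (1 : ℝ) ≤ m := by exact_mod_cast hm
  have hpos : 0 < ∑ i ∈ B, w i ^ 2 + m * A ^ 2 := by
    have : 0 ≤ ∑ i ∈ B, w i ^ 2 := Finset.sum_nonneg fun i _ => sq_nonneg _
    positivity
  set t := √(∑ i ∈ B, w i ^ 2 + m * A ^ 2) with ht
  have htpos : 0 < t := Real.sqrt_pos.2 hpos
  have htsq : t ^ 2 = ∑ i ∈ B, w i ^ 2 + m * A ^ 2 := Real.sq_sqrt hpos.le
  refine kSupportNorm_le hk (by omega) htpos fun y => ?_
  obtain ⟨J, hJ, hJm, hle⟩ := exists_card_eq_sum_mul_le Bᶜ m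
    (by rw [Finset.card_compl, Fintype.card_fin]; omega) (fun i => |w i|) (fun i => |y i|) (A := A)
    (fun i _ => abs_nonneg _) (fun i hi => hw' i (Finset.mem_compl.1 hi)) hsum.le
    (fun i _ => abs_nonneg _)
  have hdisj : Disjoint B J :=
    Finset.disjoint_left.2 fun i hi hi' => Finset.mem_compl.1 (hJ hi') hi
  -- `b / t` is the atom sought for `y`. The sign at `y i = 0` is taken as `1` so that every entry
  -- on `J` has modulus `A` and `‖b‖ = t`.
  let b : EuclideanSpace ℝ (Fin p) := WithLp.toLp 2 fun i =>
    if i ∈ B then w i else if i ∈ J then A * (if 0 ≤ y i then 1 else -1) else 0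
  have hb1 : ∀ i ∈ B, b i = w i := fun i hi => by simp [b, hi]
  have hb2 : ∀ i ∈ J, b i = A * (if 0 ≤ y i then 1 else -1) := fun i hi => by
    simp [b, hi, Finset.disjoint_right.1 hdisj hi]
  have hb3 : ∀ i, i ∉ B ∪ J → b i = 0 := fun i hi => by
    simp only [Finset.mem_union, not_or] at hi
    simp [b, hi]
  have hnorm : ‖b‖ = t := by
    rw [← sq_eq_sq₀ (norm_nonneg _) htpos.le, htsq, EuclideanSpace.real_norm_sq_eq,
      ← Finset.sum_subset (Finset.subset_univ (B ∪ J)) (fun i _ hi => by simp [hb3 i hi]),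
      Finset.sum_union hdisj, Finset.sum_congr rfl (fun i hi => by rw [hb1 i hi])]
    congr 1
    rw [← hJm, ← nsmul_eq_mul, ← Finset.sum_const]
    refine Finset.sum_congr rfl fun i hi => ?_
    rw [hb2 i hi]; split_ifs <;> ring
  refine ⟨t⁻¹ • b, ⟨(nnz_le_card (F := B ∪ J) fun i hi => ?_).trans ?_, ?_⟩, ?_⟩
  · by_contra h
    simp [hb3 i h] at hi
  · rw [Finset.card_union_of_disjoint hdisj, hJm, hB]
  · rw [norm_smul, hnorm, Real.norm_of_nonneg (by positivity), inv_mul_cancel₀ htpos.ne']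
  · rw [inner_smul_right, mul_inv_cancel_left₀ htpos.ne', PiLp.inner_apply, PiLp.inner_apply,
      ← Finset.sum_subset (Finset.subset_univ (B ∪ J)) (f := fun i => inner ℝ (y i) (b i))
        (fun i _ hi => by simp [hb3 i hi]), Finset.sum_union hdisj, ← Finset.sum_add_sum_compl B,
      Finset.sum_congr (s₁ := B) (f := fun i => inner ℝ (y i) (b i)) rfl
        (fun i hi => by rw [hb1 i hi])]
    refine add_le_add le_rfl ?_
    calc ∑ i ∈ Bᶜ, inner ℝ (y i) (w i) ≤ ∑ i ∈ Bᶜ, |w i| * |y i| :=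
          Finset.sum_le_sum fun i _ => by
            rw [← abs_mul]; simpa using le_abs_self (w i * y i)
      _ ≤ A * ∑ i ∈ J, |y i| := hle
      _ = ∑ i ∈ J, inner ℝ (y i) (b i) := by
          rw [Finset.mul_sum]
          refine Finset.sum_congr rfl fun i hi => ?_
          rw [hb2 i hi]
          by_cases h : 0 ≤ y i
          · simp [h, abs_of_nonneg h]
          · simp [h, abs_of_neg (not_le.1 h)]

/-! ### Normal vectors and projection onto the tangent cone -/

/-- Elements of the normal cone of the `k`-support norm. -/
theorem inner_nonpos_of_mem_tangentCone {p k m : ℕ} (hk : 1 ≤ k) (hm : 1 ≤ m) (hp : k ≤ p)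
    {B : Finset (Fin p)} (hB : #B + m = k) {A : ℝ} (hA : 0 < A) {w y : EuclideanSpace ℝ (Fin p)}
    (hw : ∀ i ∈ B, A ≤ |w i|) (hw' : ∀ i ∉ B, |w i| ≤ A) (hsum : ∑ i ∈ Bᶜ, |w i| = m * A)
    (hy : ∀ i ∈ B, y i = w i) (hy' : ∀ i ∉ B, |y i| ≤ A) (hyw : ∀ i ∉ B, y i * w i = A * |w i|)
    {h : EuclideanSpace ℝ (Fin p)} (hh : h ∈ tangentCone (kSupportNorm k) w) :
    inner ℝ y h ≤ 0 := by
  have hclosed : IsClosed {h : EuclideanSpace ℝ (Fin p) | inner ℝ y h ≤ 0} :=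
    isClosed_le (by fun_prop) continuous_const
  refine closure_minimal ?_ hclosed hh
  intro h hh
  simp only [Set.mem_iUnion, Set.mem_Ioi, Set.mem_ofPred_eq] at hh ⊢
  obtain ⟨τ, hτ, hle⟩ := hh
  set t := √(∑ i ∈ B, w i ^ 2 + m * A ^ 2) with ht
  have htsq : t ^ 2 = ∑ i ∈ B, w i ^ 2 + m * A ^ 2 :=
    Real.sq_sqrt (add_nonneg (Finset.sum_nonneg fun i _ => sq_nonneg _) (by positivity))
  have h1 := kSupportNorm_le_sqrt hk hm hp hB hA hw' hsum
  have h2 := inner_le_mul_kSupportNorm hk (by omega) (Real.sqrt_nonneg _)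
    (fun a ha => inner_atom_le hB hA.le (y := y) (fun i hi => (hy i hi).symm ▸ hw i hi) hy' ha)
    (w + τ • h)
  rw [Finset.sum_congr rfl (fun i hi => by rw [hy i hi]), ← ht] at h2
  have h3 : inner ℝ y w = t ^ 2 := by
    rw [htsq, PiLp.inner_apply, ← Finset.sum_add_sum_compl B]
    congr 1
    · exact Finset.sum_congr rfl fun i hi => by simp [hy i hi, sq]
    · rw [sq, ← mul_assoc, ← hsum, mul_comm, Finset.mul_sum]
      refine Finset.sum_congr rfl fun i hi => ?_
      rw [← hyw i (Finset.mem_compl.1 hi)]; simp [mul_comm]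
  rw [inner_add_right, inner_smul_right, h3] at h2
  have h4 : t * kSupportNorm k (w + τ • h) ≤ t * t :=
    mul_le_mul_of_nonneg_left (hle.trans h1) (Real.sqrt_nonneg _)
  have h5 : τ * inner ℝ y h ≤ 0 := by nlinarith
  exact nonpos_of_mul_nonpos_right h5 hτ

theorem smul_mem_tangentCone {E : Type*} [NormedAddCommGroup E] [NormedSpace ℝ E] {Ω : E → ℝ}
    {z h : E} (hh : h ∈ tangentCone Ω z) {c : ℝ} (hc : 0 < c) : c • h ∈ tangentCone Ω z := by
  refine map_mem_closure (continuous_const_smul c) hh ?_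
  intro h hh
  simp only [Set.mem_iUnion, Set.mem_Ioi, Set.mem_ofPred_eq] at hh ⊢
  obtain ⟨τ, hτ, hle⟩ := hh
  exact ⟨τ / c, by positivity, by rwa [smul_smul, div_mul_cancel₀ _ hc.ne']⟩

/-- The projection onto the tangent cone is at most the distance to any normal vector. -/
theorem norm_proj_tangentCone_le {E : Type*} [NormedAddCommGroup E] [InnerProductSpace ℝ E]
    [FiniteDimensional ℝ E] {Ω : E → ℝ} {z y : E}
    (hy : ∀ h ∈ tangentCone Ω z, inner ℝ y h ≤ 0) (g : E) :
    ‖proj (tangentCone Ω z) g‖ ≤ ‖g - y‖ := by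
  have h0 : (0 : E) ∈ tangentCone Ω z := by
    refine subset_closure ?_
    simp only [Set.mem_iUnion, Set.mem_Ioi, Set.mem_ofPred_eq]
    exact ⟨1, one_pos, by simp⟩
  obtain ⟨hu, hmin⟩ := proj_spec (K := tangentCone Ω z) isClosed_closure ⟨0, h0⟩ g
  set u := proj (tangentCone Ω z) g
  -- Compare `u` with its multiples `c • u`, which stay in the cone: `c = 1/2` when the inner
  -- product is nonpositive, otherwise the minimizer along the ray.
  have key : ‖u‖ ^ 2 ≤ inner ℝ g u := by
    by_contra! hlt
    have hupos : 0 < ‖u‖ ^ 2 := by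
      rcases eq_or_ne u 0 with h | h
      · simp [h] at hlt
      · positivity
    have hq : ∀ c : ℝ, 0 < c → ‖g‖ ^ 2 - 2 * inner ℝ g u + ‖u‖ ^ 2
        ≤ ‖g‖ ^ 2 - 2 * (c * inner ℝ g u) + c ^ 2 * ‖u‖ ^ 2 := by
      intro c hc
      have h1 := pow_le_pow_left₀ (norm_nonneg _) (hmin _ (smul_mem_tangentCone hu hc)) 2
      rw [norm_sub_sq_real, norm_sub_sq_real, inner_smul_right, norm_smul, mul_pow,
        Real.norm_of_nonneg hc.le] at h1
      exact h1
    rcases le_or_gt (inner ℝ g u) 0 with hneg | hpos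
    · have := hq (1 / 2) (by norm_num)
      nlinarith
    · have := hq (inner ℝ g u / ‖u‖ ^ 2) (by positivity)
      have e' : inner ℝ g u / ‖u‖ ^ 2 * ‖u‖ ^ 2 = inner ℝ g u := div_mul_cancel₀ _ hupos.ne'
      have e : (inner ℝ g u / ‖u‖ ^ 2) ^ 2 * ‖u‖ ^ 2 = inner ℝ g u / ‖u‖ ^ 2 * inner ℝ g u := by
        rw [sq, mul_assoc, e']
      have hx1 : inner ℝ g u / ‖u‖ ^ 2 < 1 := (div_lt_one hupos).2 hlt
      rw [e] at this
      nlinarith [mul_pos (sub_pos.2 hx1) (sub_pos.2 hlt)]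
  have h2 : ‖u‖ ^ 2 ≤ inner ℝ (g - y) u := by
    rw [inner_sub_left]; linarith [hy u hu]
  have h3 := real_inner_le_norm (g - y) u
  rcases eq_or_lt_of_le (norm_nonneg u) with h | h
  · rw [← h]; positivity
  · nlinarith

/-! ### One-dimensional Gaussian moments -/

theorem lintegral_gaussianReal_sub_sq (c : ℝ) :
    ∫⁻ x, ENNReal.ofReal ((x - c) ^ 2) ∂gaussianReal 0 1 = ENNReal.ofReal (1 + c ^ 2) := by
  have h1 : Integrable (fun x : ℝ => x) (gaussianReal 0 1) :=
    (memLp_id_gaussianReal (μ := 0) (v := 1) 1).integrable (by simp)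
  have h2 : Integrable (fun x : ℝ => x ^ 2) (gaussianReal 0 1) :=
    (memLp_id_gaussianReal (μ := 0) (v := 1) 2).integrable_sq
  have hv : ∫ x : ℝ, x ^ 2 ∂gaussianReal 0 1 = 1 := by
    have := variance_of_integral_eq_zero (μ := gaussianReal 0 1) (X := fun x => x)
      (by fun_prop) (by simp)
    rw [variance_fun_id_gaussianReal] at this
    simpa using this.symm
  have e : (fun x : ℝ => (x - c) ^ 2) = fun x => x ^ 2 - (2 * c) * x + c ^ 2 := by
    ext x; ring
  have hi : Integrable (fun x : ℝ => (x - c) ^ 2) (gaussianReal 0 1) := by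
    rw [e]; exact (h2.sub (h1.const_mul _)).add (integrable_const _)
  rw [← ofReal_integral_eq_lintegral_ofReal hi (ae_of_all _ fun x => sq_nonneg _), e,
    integral_add (f := fun x : ℝ => x ^ 2 - 2 * c * x) (h2.sub (h1.const_mul _))
      (integrable_const _),
    integral_sub h2 (h1.const_mul _), integral_const_mul, hv]
  simp

theorem integral_Ioi_mul_exp_neg_sq_half :
    ∫ x in Set.Ioi (0 : ℝ), x * Real.exp (-(x ^ 2 / 2)) = 1 := by
  have := integral_rpow_mul_exp_neg_mul_rpow (p := 2) (q := 1) (b := 1 / 2)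
    (by norm_num) (by norm_num) (by norm_num)
  norm_num at this
  rw [← this]
  congr 1; ext x; congr 2; ring

theorem lintegral_Ioi_mul_exp_neg_sq_half {C : ℝ} (hC : 0 ≤ C) :
    ∫⁻ x, (Set.Ioi (0 : ℝ)).indicator
      (fun x => ENNReal.ofReal (C * (x * Real.exp (-(x ^ 2 / 2))))) x = ENNReal.ofReal C := by
  have hi : IntegrableOn (fun x : ℝ => x * Real.exp (-(x ^ 2 / 2))) (Set.Ioi 0) :=
    -- A nonintegrable function has integral `0` by convention, so the value `1` gives
    -- integrability.
    Integrable.of_integral_ne_zero (by rw [integral_Ioi_mul_exp_neg_sq_half]; norm_num)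
  rw [lintegral_indicator measurableSet_Ioi,
    ← ofReal_integral_eq_lintegral_ofReal (hi.const_mul C), integral_const_mul,
    integral_Ioi_mul_exp_neg_sq_half, mul_one]
  filter_upwards [ae_restrict_mem measurableSet_Ioi] with x hx
  have : (0 : ℝ) < x := hx
  positivity

/-- Expanding `(u + τ)²` leaves a factor `u e^{-uτ}`, whose maximum is `1 / (eτ)`; the remaining `u
e^{-u²/2}` has integral `1` on the half-line. -/
theorem sq_mul_gaussianPDFReal_le {τ u : ℝ} (hτ : 0 < τ) (hu : 0 < u) :
    gaussianPDFReal 0 1 (u + τ) * u ^ 2 ≤ Real.exp (-(τ ^ 2 / 2)) /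
      (Real.exp 1 * τ * √(2 * Real.pi)) * (u * Real.exp (-(u ^ 2 / 2))) := by
  have h1 : u * τ * Real.exp 1 ≤ Real.exp (u * τ) := by
    have := Real.add_one_le_exp (u * τ - 1)
    rw [Real.exp_sub, le_div_iff₀ (Real.exp_pos _)] at this
    linarith
  have h2 : u * Real.exp (-(u * τ)) ≤ 1 / (Real.exp 1 * τ) := by
    rw [Real.exp_neg, ← div_eq_mul_inv, div_le_div_iff₀ (Real.exp_pos _) (by positivity)]
    linarith
  have h3 : gaussianPDFReal 0 1 (u + τ) = (√(2 * Real.pi))⁻¹ *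
      (Real.exp (-(u ^ 2 / 2)) * Real.exp (-(u * τ)) * Real.exp (-(τ ^ 2 / 2))) := by
    rw [gaussianPDFReal, ← Real.exp_add, ← Real.exp_add]
    simp only [NNReal.coe_one, mul_one, sub_zero]
    congr 2; ring
  calc gaussianPDFReal 0 1 (u + τ) * u ^ 2
      = (√(2 * Real.pi))⁻¹ * Real.exp (-(τ ^ 2 / 2)) * (u * Real.exp (-(u ^ 2 / 2))) *
          (u * Real.exp (-(u * τ))) := by rw [h3]; ring
    _ ≤ (√(2 * Real.pi))⁻¹ * Real.exp (-(τ ^ 2 / 2)) * (u * Real.exp (-(u ^ 2 / 2))) *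
          (1 / (Real.exp 1 * τ)) := by gcongr
    _ = _ := by field_simp

/-- The second moment of the soft thresholding of a standard Gaussian variable. -/
theorem lintegral_gaussianReal_softThreshold_le {τ : ℝ} (hτ : 0 < τ) :
    ∫⁻ x, ENNReal.ofReal ((x - max (-τ) (min x τ)) ^ 2) ∂gaussianReal 0 1 ≤
      ENNReal.ofReal (2 * (Real.exp (-(τ ^ 2 / 2)) / (Real.exp 1 * τ * √(2 * Real.pi)))) := by
  set C := Real.exp (-(τ ^ 2 / 2)) / (Real.exp 1 * τ * √(2 * Real.pi)) with hCdef
  have hC : 0 ≤ C := by positivity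
  set G : ℝ → ENNReal := (Set.Ioi (0 : ℝ)).indicator
      (fun x => ENNReal.ofReal (C * (x * Real.exp (-(x ^ 2 / 2))))) with hG
  have hGm : Measurable G := Measurable.indicator (by fun_prop) measurableSet_Ioi
  rw [gaussianReal_of_var_ne_zero _ one_ne_zero,
    lintegral_withDensity_eq_lintegral_mul _ (measurable_gaussianPDF _ _) (by fun_prop)]
  -- The two terms cover the tails `x > τ` and `x < -τ`; the integrand vanishes in between.
  calc _ ≤ ∫⁻ x, (G (x - τ) + G (-τ - x)) := by
        refine lintegral_mono fun x => ?_
        simp only [Pi.mul_apply, gaussianPDF]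
        rw [← ENNReal.ofReal_mul (gaussianPDFReal_nonneg _ _ _)]
        rcases lt_or_ge τ x with h | h
        · refine le_trans ?_ (le_add_of_nonneg_right zero_le)
          rw [hG, Set.indicator_of_mem (Set.mem_Ioi.2 (sub_pos.2 h)), min_eq_right h.le,
            max_eq_right (by linarith)]
          have := sq_mul_gaussianPDFReal_le hτ (sub_pos.2 h)
          rw [sub_add_cancel] at this
          exact ENNReal.ofReal_le_ofReal this
        rcases lt_or_ge x (-τ) with h' | h'
        · refine le_trans ?_ (le_add_of_nonneg_left zero_le)
          rw [hG, Set.indicator_of_mem (Set.mem_Ioi.2 (sub_pos.2 h')), min_eq_left h,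
            max_eq_left h'.le]
          have := sq_mul_gaussianPDFReal_le hτ (sub_pos.2 h')
          have e : gaussianPDFReal 0 1 (-τ - x + τ) = gaussianPDFReal 0 1 x := by
            have : (-τ - x + τ) ^ 2 = x ^ 2 := by ring
            simp [gaussianPDFReal, this]
          rw [e] at this
          refine ENNReal.ofReal_le_ofReal (le_trans (le_of_eq ?_) this)
          ring
        · simp [min_eq_left h, max_eq_right h']
    _ = (∫⁻ x, G x) + ∫⁻ x, G x := by
        rw [lintegral_add_left (by fun_prop), lintegral_sub_right_eq_self G,
          lintegral_sub_left_eq_self G]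
    _ = ENNReal.ofReal (2 * C) := by
        rw [lintegral_Ioi_mul_exp_neg_sq_half hC, ← ENNReal.ofReal_add hC hC, two_mul]

theorem lintegral_stdGaussian_eval {p : ℕ} (i : Fin p) {F : ℝ → ENNReal} (hF : Measurable F) :
    ∫⁻ g, F (g i) ∂stdGaussian (EuclideanSpace ℝ (Fin p)) = ∫⁻ x, F x ∂gaussianReal 0 1 := by
  rw [← map_pi_eq_stdGaussian, lintegral_map (by fun_prop) (by fun_prop),
    ← (measurePreserving_eval (fun _ : Fin p => gaussianReal 0 1) i).lintegral_comp hF]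

/-- With `e^{-τ²/2} = s / p` the left side is `2s (1 - s/p) / (eτ√(2π))`, so the quotient must be at
most `1/8`. -/
theorem tail_constant_le {p s : ℝ} (hs : 0 < s) (hsp : s < p) {τ : ℝ} (hτ : 0 < τ)
    (hτ2 : τ ^ 2 = 2 * Real.log (p / s)) :
    (p - s) * (2 * (Real.exp (-(τ ^ 2 / 2)) / (Real.exp 1 * τ * √(2 * Real.pi)))) ≤ s / 4 := by
  have hp : 0 < p := hs.trans hsp
  have hexp : Real.exp (-(τ ^ 2 / 2)) = s / p := by
    rw [hτ2, mul_div_cancel_left₀ _ two_ne_zero, Real.exp_neg, Real.exp_log (by positivity),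
      inv_div]
  have hm1 : 1 - s / p ≤ τ ^ 2 / 2 := by
    have := Real.add_one_le_exp (-(τ ^ 2 / 2))
    rw [hexp] at this; linarith
  have hm0 : 0 ≤ 1 - s / p := sub_nonneg.2 ((div_le_one hp).2 hsp.le)
  have hm2 : 1 - s / p ≤ 1 := by
    have : 0 < s / p := by positivity
    linarith
  have he : (2.7 : ℝ) ≤ Real.exp 1 := by have := Real.exp_one_gt_d9; linarith
  -- After squaring: `64 (1 - s/p)² ≤ 32 τ²`, while `e² · 2π > 7.29 · 6 > 32`.
  have hkey : (1 - s / p) * 8 ≤ Real.exp 1 * τ * √(2 * Real.pi) := by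
    refine abs_le_of_sq_le_sq' ?_ (by positivity) |>.2
    rw [mul_pow, mul_pow, mul_pow, Real.sq_sqrt (by positivity)]
    have h1 : (1 - s / p) ^ 2 ≤ τ ^ 2 / 2 := by nlinarith
    have h2 : (7.29 : ℝ) ≤ Real.exp 1 ^ 2 := by nlinarith
    have h3 : 7.29 * τ ^ 2 * (2 * 3) ≤ Real.exp 1 ^ 2 * τ ^ 2 * (2 * Real.pi) := by
      have := Real.pi_gt_three
      gcongr
    nlinarith [sq_nonneg τ]
  rw [hexp]
  have e : (p - s) * (2 * (s / p / (Real.exp 1 * τ * √(2 * Real.pi)))) =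
      2 * s * ((1 - s / p) / (Real.exp 1 * τ * √(2 * Real.pi))) := by
    field_simp
  have h8 : (1 - s / p) / (Real.exp 1 * τ * √(2 * Real.pi)) ≤ 1 / 8 := by
    rw [div_le_div_iff₀ (by positivity) (by norm_num)]; linarith
  rw [e]
  nlinarith

/-! ### The bound for index sets -/

/-- The bound in terms of the set `B` of large entries and a set `C` containing the support. -/
theorem statisticalDimension_le {p k m : ℕ} (hk : 1 ≤ k) (hm : 1 ≤ m)
    {B C : Finset (Fin p)} (hB : #B + m = k) (hBC : B ⊆ C) (hkC : k ≤ #C) {A : ℝ} (hA : 0 < A)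
    {w : EuclideanSpace ℝ (Fin p)}
    (hw : ∀ i ∈ B, A ≤ |w i|) (hw' : ∀ i ∉ B, |w i| ≤ A) (hsum : ∑ i ∈ Bᶜ, |w i| = m * A)
    (hC : ∀ i ∉ C, w i = 0) :
    statisticalDimension w (kSupportNorm k) ≤ ENNReal.ofReal (5 / 4 * #C +
      2 * ((∑ i ∈ B, w i ^ 2) / A ^ 2 + (#C - #B : ℝ)) * Real.log (p / #C)) := by
  classical
  have hCp : #C ≤ p := by simpa using Finset.card_le_univ C
  have hs0 : (0 : ℝ) < #C := by exact_mod_cast (by omega : 0 < #C)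
  have hsp : (#C : ℝ) ≤ p := by exact_mod_cast hCp
  have hlog : 0 ≤ Real.log (p / #C) := Real.log_nonneg ((one_le_div hs0).2 hsp)
  set τ := √(2 * Real.log (p / #C)) with hτdef
  have hτ : 0 ≤ τ := Real.sqrt_nonneg _
  have hτ2 : τ ^ 2 = 2 * Real.log (p / #C) := Real.sq_sqrt (by positivity)
  -- `η i (g i)` is the `i`-th entry of the scaled normal vector. It depends on `g i` alone, so the
  -- expectation splits into one-dimensional integrals.
  let η : Fin p → ℝ → ℝ := fun i x => if i ∈ B then τ / A * w i else
    if i ∈ C then τ * (SignType.sign (w i) : ℝ) else max (-τ) (min x τ)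
  have hη1 : ∀ i ∈ B, ∀ x, η i x = τ / A * w i := fun i hi x => by simp [η, hi]
  have hη2 : ∀ i ∈ C \ B, ∀ x, η i x = τ * (SignType.sign (w i) : ℝ) := fun i hi x => by
    rw [Finset.mem_sdiff] at hi; simp [η, hi]
  have hη3 : ∀ i ∉ C, ∀ x, η i x = max (-τ) (min x τ) := fun i hi x => by
    have : i ∉ B := fun h => hi (hBC h)
    simp [η, hi, this]
  have hmeas : ∀ i, Measurable fun x => ENNReal.ofReal ((x - η i x) ^ 2) := by
    intro i
    by_cases h1 : i ∈ B
    · simp only [hη1 i h1]; fun_prop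
    by_cases h2 : i ∈ C
    · simp only [hη2 i (Finset.mem_sdiff.2 ⟨h2, h1⟩)]; fun_prop
    · simp only [hη3 i h2]; fun_prop
  have hsign : ∀ a : ℝ, |(SignType.sign a : ℝ)| ≤ 1 := by
    intro a; rcases lt_trichotomy a 0 with h | h | h <;> simp [h]
  have hpt : ∀ g : EuclideanSpace ℝ (Fin p),
      ENNReal.ofReal (‖proj (tangentCone (kSupportNorm k) w) g‖ ^ 2) ≤
        ∑ i, ENNReal.ofReal ((g i - η i (g i)) ^ 2) := by
    intro g
    let y : EuclideanSpace ℝ (Fin p) := WithLp.toLp 2 fun i => if i ∈ B then w i else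
      A * (if i ∈ C then (SignType.sign (w i) : ℝ) else max (-τ) (min (g i) τ) / τ)
    have hyη : (τ / A) • y = WithLp.toLp 2 fun i => η i (g i) := by
      ext i
      by_cases h1 : i ∈ B
      · simp [y, hη1 i h1, h1]
      by_cases h2 : i ∈ C
      · simp [y, hη2 i (Finset.mem_sdiff.2 ⟨h2, h1⟩), h1, h2]; field_simp
      · simp only [PiLp.smul_apply, y, hη3 i h2, h1, h2, if_false, smul_eq_mul]
        -- If `τ = 0` both sides vanish, division by zero being `0`.
        rcases hτ.eq_or_lt with h | h
        · simp [← h]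
        · field_simp
    have hyB : ∀ i ∈ B, y i = w i := fun i hi => by simp [y, hi]
    have hyA : ∀ i ∉ B, |y i| ≤ A := by
      intro i hi
      simp only [y, hi, if_false]
      rw [abs_mul, abs_of_pos hA]
      refine mul_le_of_le_one_right hA.le ?_
      split_ifs
      · exact hsign _
      · rw [abs_div, abs_of_nonneg hτ]
        refine div_le_one_of_le₀ (abs_le.2 ⟨le_max_left _ _, max_le (by linarith) ?_⟩) hτ
        exact min_le_right _ _
    have hyw : ∀ i ∉ B, y i * w i = A * |w i| := by
      intro i hi
      by_cases h2 : i ∈ C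
      · simp [y, hi, h2, mul_assoc, sign_mul_self]
      · simp [hC i h2]
    have hle := norm_proj_tangentCone_le (Ω := kSupportNorm k) (z := w) (y := (τ / A) • y)
      (fun h hh => by
        rw [inner_smul_left]
        exact mul_nonpos_of_nonneg_of_nonpos (by simp; positivity)
          (inner_nonpos_of_mem_tangentCone hk hm (by omega) hB hA hw hw' hsum hyB hyA hyw hh)) g
    rw [← ENNReal.ofReal_sum_of_nonneg fun i _ => sq_nonneg _]
    refine ENNReal.ofReal_le_ofReal ((pow_le_pow_left₀ (norm_nonneg _) hle 2).trans (le_of_eq ?_))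
    rw [EuclideanSpace.real_norm_sq_eq, hyη]
    rfl
  set D : ℝ := 2 * (Real.exp (-(τ ^ 2 / 2)) / (Real.exp 1 * τ * √(2 * Real.pi))) with hD
  have hD0 : 0 ≤ D := by positivity
  let β : Fin p → ℝ := fun i => if i ∈ B then 1 + (τ / A * w i) ^ 2 else
    if i ∈ C then 1 + τ ^ 2 else D
  have hβ0 : ∀ i, 0 ≤ β i := fun i => by simp only [β]; split_ifs <;> positivity
  have hτpos : ∀ i ∉ C, (#C : ℝ) < p ∧ 0 < τ := by
    intro i hi
    have h0 : C ≠ univ := fun h => hi (h ▸ mem_univ i)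
    have h1 : #C < p := by simpa using Finset.card_lt_card (Finset.ssubset_univ_iff.2 h0)
    have h2 : (#C : ℝ) < p := by exact_mod_cast h1
    exact ⟨h2, Real.sqrt_pos.2 (mul_pos two_pos (Real.log_pos ((one_lt_div hs0).2 h2)))⟩
  have hone : ∀ i, ∫⁻ x, ENNReal.ofReal ((x - η i x) ^ 2) ∂gaussianReal 0 1 ≤
      ENNReal.ofReal (β i) := by
    intro i
    by_cases h1 : i ∈ B
    · simp only [hη1 i h1, β, h1, if_true]
      exact (lintegral_gaussianReal_sub_sq _).le
    by_cases h2 : i ∈ C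
    · simp only [hη2 i (Finset.mem_sdiff.2 ⟨h2, h1⟩), β, h1, h2, if_true, if_false]
      rw [lintegral_gaussianReal_sub_sq]
      -- Only an inequality: `C` may exceed the support, where the sign is `0`.
      refine ENNReal.ofReal_le_ofReal (add_le_add le_rfl ?_)
      rw [mul_pow]
      refine mul_le_of_le_one_right (sq_nonneg _) ?_
      rw [← sq_abs]
      exact pow_le_one₀ (abs_nonneg _) (hsign _)
    · simp only [hη3 i h2, β, h1, h2, if_false]
      exact lintegral_gaussianReal_softThreshold_le (hτpos i h2).2
  have hβsum : ∑ i, β i ≤ 5 / 4 * #C +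
      2 * ((∑ i ∈ B, w i ^ 2) / A ^ 2 + (#C - #B : ℝ)) * Real.log (p / #C) := by
    have e1 : ∑ i ∈ B, β i = #B + τ ^ 2 * ((∑ i ∈ B, w i ^ 2) / A ^ 2) := by
      rw [Finset.sum_congr rfl (g := fun i => 1 + τ ^ 2 / A ^ 2 * w i ^ 2)
        (fun i hi => by simp only [β, hi, if_true]; ring), Finset.sum_add_distrib,
        ← Finset.mul_sum]
      simp; ring
    have e2 : ∑ i ∈ C \ B, β i = (#C - #B : ℝ) * (1 + τ ^ 2) := by
      rw [Finset.sum_congr rfl (g := fun _ => 1 + τ ^ 2) (fun i hi => by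
        rw [Finset.mem_sdiff] at hi; simp [β, hi]), Finset.sum_const,
        Finset.card_sdiff_of_subset hBC, nsmul_eq_mul, Nat.cast_sub (Finset.card_le_card hBC)]
    have e3 : ∑ i ∈ Cᶜ, β i ≤ #C / 4 := by
      rw [Finset.sum_congr rfl (g := fun _ => D) (fun i hi => by
        have h2 := Finset.mem_compl.1 hi
        have h1 : i ∉ B := fun h => h2 (hBC h)
        simp [β, h1, h2]), Finset.sum_const, Finset.card_compl, Fintype.card_fin, nsmul_eq_mul,
        Nat.cast_sub hCp]
      -- When `#C = p` no coordinate is left and the degenerate value of `D` at `τ = 0` is harmless.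
      rcases hsp.eq_or_lt with h | h
      · rw [h, sub_self, zero_mul]; positivity
      · exact tail_constant_le hs0 h
          (Real.sqrt_pos.2 (mul_pos two_pos (Real.log_pos ((one_lt_div hs0).2 h)))) hτ2
    rw [← Finset.sum_add_sum_compl C, ← Finset.sum_sdiff hBC, e1, e2, hτ2]
    linarith
  calc statisticalDimension w (kSupportNorm k)
      ≤ ∫⁻ g, ∑ i, ENNReal.ofReal ((g i - η i (g i)) ^ 2)
          ∂stdGaussian (EuclideanSpace ℝ (Fin p)) := lintegral_mono hpt
    _ = ∑ i, ∫⁻ x, ENNReal.ofReal ((x - η i x) ^ 2) ∂gaussianReal 0 1 := by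
        rw [lintegral_finsetSum (f := fun i (g : EuclideanSpace ℝ (Fin p)) =>
          ENNReal.ofReal ((g i - η i (g i)) ^ 2)) _ fun i _ => (hmeas i).comp (by fun_prop)]
        exact Finset.sum_congr rfl fun i _ => lintegral_stdGaussian_eval i (hmeas i)
    _ ≤ ∑ i, ENNReal.ofReal (β i) := Finset.sum_le_sum fun i _ => hone i
    _ = ENNReal.ofReal (∑ i, β i) := (ENNReal.ofReal_sum_of_nonneg fun i _ => hβ0 i).symm
    _ ≤ _ := ENNReal.ofReal_le_ofReal hβsum

/-! ### The sorted vector -/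

/-- The position, between `1` and `p`, of the index `j` in the sorted vector. -/
noncomputable def rank {p : ℕ} (w : EuclideanSpace ℝ (Fin p)) (j : Fin p) : ℕ :=
  (Tuple.sort fun j => -|w j|).symm j + 1

theorem one_le_rank {p : ℕ} (w : EuclideanSpace ℝ (Fin p)) (j : Fin p) : 1 ≤ rank w j := by
  simp [rank]

theorem rank_le {p : ℕ} (w : EuclideanSpace ℝ (Fin p)) (j : Fin p) : rank w j ≤ p :=
  ((Tuple.sort fun j => -|w j|).symm j).isLt

theorem rank_injective {p : ℕ} (w : EuclideanSpace ℝ (Fin p)) : Function.Injective (rank w) := by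
  intro i j h
  simpa [rank, Fin.val_inj] using h

theorem exists_rank_eq {p : ℕ} (w : EuclideanSpace ℝ (Fin p)) {n : ℕ} (h1 : 1 ≤ n) (hn : n ≤ p) :
    ∃ j, rank w j = n :=
  ⟨(Tuple.sort fun j => -|w j|) ⟨n - 1, by omega⟩, by simp [rank]; omega⟩

theorem sortedEntry_rank {p : ℕ} (w : EuclideanSpace ℝ (Fin p)) (j : Fin p) :
    sortedEntry w (rank w j) = w j := by
  rw [sortedEntry, dif_pos ⟨one_le_rank w j, rank_le w j⟩]
  exact congrArg w ((Tuple.sort fun j => -|w j|).apply_symm_apply j)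

theorem abs_sortedEntry_anti {p : ℕ} (w : EuclideanSpace ℝ (Fin p)) {i j : ℕ} (hi : 1 ≤ i)
    (hij : i ≤ j) : |sortedEntry w j| ≤ |sortedEntry w i| := by
  by_cases hj : j ≤ p
  · rw [sortedEntry, sortedEntry, dif_pos ⟨by omega, hj⟩, dif_pos ⟨hi, by omega⟩]
    have := Tuple.monotone_sort (fun j => -|w j|) (a := ⟨i - 1, by omega⟩) (b := ⟨j - 1, by omega⟩)
      (Fin.mk_le_mk.2 (by omega))
    simpa using this
  · rw [sortedEntry, dif_neg (by omega)]; simp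

theorem image_rank_filter {p : ℕ} (w : EuclideanSpace ℝ (Fin p)) {S : Finset ℕ}
    (hS : S ⊆ Icc 1 p) : (univ.filter fun j => rank w j ∈ S).image (rank w) = S := by
  ext n
  simp only [Finset.mem_image, Finset.mem_filter, Finset.mem_univ, true_and]
  refine ⟨fun ⟨j, hj, h⟩ => h ▸ hj, fun hn => ?_⟩
  obtain ⟨h1, h2⟩ := Finset.mem_Icc.1 (hS hn)
  obtain ⟨j, rfl⟩ := exists_rank_eq w h1 h2
  exact ⟨j, hn, rfl⟩

theorem card_filter_rank {p : ℕ} (w : EuclideanSpace ℝ (Fin p)) {S : Finset ℕ}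
    (hS : S ⊆ Icc 1 p) : #(univ.filter fun j => rank w j ∈ S) = #S := by
  conv_rhs => rw [← image_rank_filter w hS, Finset.card_image_of_injective _ (rank_injective w)]

theorem sum_sortedEntry {p : ℕ} (w : EuclideanSpace ℝ (Fin p)) {S : Finset ℕ}
    (hS : S ⊆ Icc 1 p) (f : ℝ → ℝ) :
    ∑ i ∈ S, f (sortedEntry w i) = ∑ j with rank w j ∈ S, f (w j) := by
  conv_lhs => rw [← image_rank_filter w hS, Finset.sum_image (rank_injective w).injOn]
  simp only [sortedEntry_rank]

/-- If the `n`-th entry vanished, all nonzero coordinates would have rank below `n`. -/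
theorem sortedEntry_ne_zero {p : ℕ} {w : EuclideanSpace ℝ (Fin p)} {n : ℕ} (h1 : 1 ≤ n)
    (hn : n ≤ nnz w) (hp : n ≤ p) : sortedEntry w n ≠ 0 := by
  intro h0
  have := nnz_le_card (w := w) (F := univ.filter fun j => rank w j ∈ Icc 1 (n - 1)) (by
    intro j hj
    simp only [Finset.mem_filter, Finset.mem_univ, true_and, Finset.mem_Icc, one_le_rank]
    by_contra hlt
    have h := abs_sortedEntry_anti w h1 (j := rank w j) (by omega)
    rw [h0, sortedEntry_rank, abs_zero] at h
    exact hj (abs_nonpos_iff.1 h))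
  rw [card_filter_rank w (Finset.Icc_subset_Icc_right (by omega)), Nat.card_Icc] at this
  omega

theorem sortedEntry_eq_zero {p : ℕ} {w : EuclideanSpace ℝ (Fin p)} {n : ℕ} (hn : nnz w < n) :
    sortedEntry w n = 0 := by
  by_cases hp : n ≤ p
  · by_contra h0
    have hsub : ((univ.filter fun j => rank w j ∈ Icc 1 n : Finset (Fin p)) : Set (Fin p)) ⊆
        {i : Fin p | w i ≠ 0} := by
      intro j hj
      simp only [Finset.coe_filter, Set.mem_ofPred_eq, Finset.mem_univ, true_and,
        Finset.mem_Icc] at hj ⊢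
      intro hj0
      have h := abs_sortedEntry_anti w hj.1 hj.2
      rw [sortedEntry_rank, hj0, abs_zero] at h
      exact h0 (abs_nonpos_iff.1 h)
    have := Set.ncard_le_ncard hsub (Set.toFinite _)
    rw [Set.ncard_coe_finset, card_filter_rank w (Finset.Icc_subset_Icc_right hp),
      Nat.card_Icc] at this
    rw [nnz] at hn
    omega
  · rw [sortedEntry, dif_neg (by omega)]

/-! ### The breakpoint `r` -/

theorem sum_Icc_eq_add {M : Type*} [AddCommMonoid M] (f : ℕ → M) {a b : ℕ} (h : a ≤ b) :
    ∑ i ∈ Icc a b, f i = f a + ∑ i ∈ Icc (a + 1) b, f i := by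
  rw [← Finset.insert_Icc_add_one_left_eq_Icc h, Finset.sum_insert (by simp)]

/-- Existence and uniqueness of the breakpoint of a nonincreasing nonnegative sequence. -/
theorem existsUnique_breakpoint {c : ℕ → ℝ} (hc0 : ∀ i, 0 ≤ c i)
    (hc : ∀ i j, 1 ≤ i → i ≤ j → c j ≤ c i) {k p : ℕ} (hk : 1 ≤ k) (hkp : k ≤ p) :
    ∃! r : ℕ, r < k ∧
      (k - r - 1 = 0 ∨ 1 / ((r : ℝ) + 1) * ∑ i ∈ Icc (k - r) p, c i < c (k - r - 1)) ∧
      c (k - r) ≤ 1 / ((r : ℝ) + 1) * ∑ i ∈ Icc (k - r) p, c i := by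
  let P : ℕ → Prop := fun r => ((r : ℝ) + 1) * c (k - r) ≤ ∑ i ∈ Icc (k - r) p, c i
  -- Cancelling the first term of the sum in `P (r + 1)` shows that the strict inequality for `r` is
  -- the negation of `P (r + 1)`. As `P` is downward closed and `P 0` holds, `r` is the largest
  -- index below `k` satisfying `P`.
  have hstep : ∀ r, r + 1 < k →
      (P (r + 1) ↔ ((r : ℝ) + 1) * c (k - r - 1) ≤ ∑ i ∈ Icc (k - r) p, c i) := by
    intro r hr
    simp only [P]
    rw [← Nat.sub_sub, sum_Icc_eq_add c (by omega : k - r - 1 ≤ p), Nat.sub_add_cancel (by omega)]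
    push_cast
    constructor <;> intro h <;> linarith
  have hiff : ∀ r, (r < k ∧
      (k - r - 1 = 0 ∨ 1 / ((r : ℝ) + 1) * ∑ i ∈ Icc (k - r) p, c i < c (k - r - 1)) ∧
      c (k - r) ≤ 1 / ((r : ℝ) + 1) * ∑ i ∈ Icc (k - r) p, c i) ↔
      (r < k ∧ (r + 1 < k → ¬ P (r + 1)) ∧ P r) := by
    intro r
    have hr1 : (0 : ℝ) < r + 1 := by positivity
    refine and_congr_right fun hr => and_congr ?_ ?_
    · rcases Nat.lt_or_ge (r + 1) k with h | h
      · rw [hstep r h, not_le, one_div, inv_mul_lt_iff₀ hr1]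
        simp only [h, forall_const, or_iff_right_iff_imp]
        omega
      · simp only [not_lt.2 h, false_imp_iff, iff_true]
        left; omega
    · rw [one_div, le_inv_mul_iff₀ hr1]
  have hanti : ∀ r, r + 1 < k → P (r + 1) → P r := by
    intro r hr h
    rw [hstep r hr] at h
    refine le_trans ?_ h
    exact mul_le_mul_of_nonneg_left (hc _ _ (by omega) (by omega)) (by positivity)
  have hanti' : ∀ r r', r ≤ r' → r' < k → P r' → P r := by
    intro r r' hrr'
    induction r', hrr' using Nat.le_induction with
    | base => exact fun _ h => h
    | succ n _ ih => exact fun hn h => ih (by omega) (hanti n hn h)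
  have hP0 : P 0 := by
    simp only [P]
    rw [sum_Icc_eq_add c (by omega : k - 0 ≤ p)]
    have := Finset.sum_nonneg (s := Icc (k - 0 + 1) p) fun i _ => hc0 i
    push_cast
    linarith
  simp only [hiff]
  classical
  obtain ⟨r, hr, hmax⟩ := Finset.exists_max_image ((range k).filter P) id
    ⟨0, by simp [hP0]; omega⟩
  simp only [Finset.mem_filter, Finset.mem_range, id] at hr hmax
  refine ⟨r, ⟨hr.1, fun h hP => ?_, hr.2⟩, fun r' hr' => ?_⟩
  · have := hmax (r + 1) ⟨h, hP⟩
    omega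
  · rcases lt_trichotomy r' r with h | h | h
    · exact absurd (hanti' (r' + 1) r h hr.1 hr.2) (hr'.2.1 (by omega))
    · exact h
    · have := hmax r' ⟨hr'.1, hr'.2.2⟩
      omega

/-! ### The bounds for sorted vectors and for atoms -/

theorem nnz_le {p : ℕ} (w : EuclideanSpace ℝ (Fin p)) : nnz w ≤ p := by
  simpa using nnz_le_card (w := w) (F := univ) (by simp)

/-- The bound of the statistical dimension in terms of the sorted vector. -/
theorem statisticalDimension_le_of_isIndex {p k s r : ℕ} (hk : 1 ≤ k)
    {w : EuclideanSpace ℝ (Fin p)} (hkw : k ≤ nnz w) (hws : nnz w ≤ s) (hsp : s ≤ p)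
    (hr : IsIndex k w r) :
    statisticalDimension w (kSupportNorm k) ≤ ENNReal.ofReal (5 / 4 * (s : ℝ) +
      2 * (((r : ℝ) + 1) ^ 2 * (∑ i ∈ Icc 1 (k - r - 1), |sortedEntry w i| ^ 2) /
        (∑ i ∈ Icc (k - r) s, |sortedEntry w i|) ^ 2 + (#(Icc (k - r) s) : ℝ)) *
        Real.log ((p : ℝ) / (s : ℝ))) := by
  obtain ⟨hrk, h1, h2⟩ := hr
  have hr1 : (0 : ℝ) < r + 1 := by positivity
  have hsumeq : ∑ i ∈ Icc (k - r) s, |sortedEntry w i| = ∑ i ∈ Icc (k - r) p, |sortedEntry w i| := by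
    refine Finset.sum_subset (Finset.Icc_subset_Icc_right hsp) fun i hi hi' => ?_
    simp only [Finset.mem_Icc, not_and, not_le] at hi hi'
    rw [sortedEntry_eq_zero (hws.trans_lt (hi' hi.1)), abs_zero]
  have hSpos : 0 < ∑ i ∈ Icc (k - r) p, |sortedEntry w i| := by
    refine Finset.sum_pos' (fun i _ => abs_nonneg _) ⟨k - r, Finset.mem_Icc.2 ⟨le_rfl, by omega⟩, ?_⟩
    exact abs_pos.2 (sortedEntry_ne_zero (by omega) (by omega) (by omega))
  rw [hsumeq]
  set S := ∑ i ∈ Icc (k - r) p, |sortedEntry w i| with hS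
  set B : Finset (Fin p) := univ.filter fun j => rank w j ∈ Icc 1 (k - r - 1) with hB
  set C : Finset (Fin p) := univ.filter fun j => rank w j ∈ Icc 1 s with hC
  have hBs : Icc 1 (k - r - 1) ⊆ Icc 1 p := Finset.Icc_subset_Icc_right (by omega)
  have hBcard : #B = k - r - 1 := by rw [hB, card_filter_rank w hBs]; simp
  have hCcard : #C = s := by
    rw [hC, card_filter_rank w (Finset.Icc_subset_Icc_right hsp)]; simp
  have hBC : B ⊆ C := by
    intro j
    simp only [hB, hC, Finset.mem_filter, Finset.mem_univ, true_and, Finset.mem_Icc]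
    omega
  have hBmem : ∀ j, j ∈ B ↔ rank w j ≤ k - r - 1 := fun j => by
    simp [hB, one_le_rank]
  have hBc : Bᶜ = univ.filter fun j => rank w j ∈ Icc (k - r) p := by
    ext j
    simp only [Finset.mem_compl, hBmem, Finset.mem_filter, Finset.mem_univ, true_and,
      Finset.mem_Icc, rank_le, and_true]
    omega
  -- The two inequalities defining `r` say exactly that `A` separates the entries in `B` from the
  -- others.
  have main := statisticalDimension_le (k := k) (m := r + 1) hk (by omega) (B := B) (C := C)
    (by omega) hBC (by omega) (A := 1 / ((r : ℝ) + 1) * S) (by positivity) (w := w)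
    (fun j hj => by
      rw [hBmem] at hj
      have := one_le_rank w j
      rcases h1 with h | h
      · omega
      · refine h.le.trans ?_
        rw [← sortedEntry_rank w j]
        exact abs_sortedEntry_anti w this hj)
    (fun j hj => by
      rw [hBmem] at hj
      refine le_trans ?_ h2
      rw [← sortedEntry_rank w j]
      exact abs_sortedEntry_anti w (by omega) (by omega))
    (by
      rw [hBc, ← sum_sortedEntry w (Finset.Icc_subset_Icc_left (by omega)) fun x => |x|, ← hS]
      push_cast
      field_simp)
    (fun j hj => by
      rw [← sortedEntry_rank w j]
      refine sortedEntry_eq_zero ?_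
      simp only [hC, Finset.mem_filter, Finset.mem_univ, true_and, Finset.mem_Icc, one_le_rank,
        not_le] at hj
      omega)
  convert main using 3
  · rw [hCcard]
  · rw [hCcard, hBcard, Nat.card_Icc, hB, ← sum_sortedEntry w hBs fun x => x ^ 2]
    congr 2
    congr 1
    · simp only [sq_abs]
      field_simp
    · rw [← Nat.cast_sub (by omega)]
      congr 1; omega

theorem existsUnique_isIndex {p k : ℕ} (hk : 1 ≤ k) (hkp : k ≤ p)
    (w : EuclideanSpace ℝ (Fin p)) : ∃! r : ℕ, IsIndex k w r :=
  existsUnique_breakpoint (c := fun i => |sortedEntry w i|) (fun _ => abs_nonneg _)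
    (fun _ _ hi hij => abs_sortedEntry_anti w hi hij) hk hkp

/-- For an atom with `k` nonzero entries, the coefficient of the logarithm is controlled by the
strength. -/
theorem coefficient_le_strength {p k r : ℕ} (hrk : r < k) {a : EuclideanSpace ℝ (Fin p)}
    (ha : ‖a‖ = 1) (hak : nnz a = k) :
    ((r : ℝ) + 1) ^ 2 * (∑ i ∈ Icc 1 (k - r - 1), |sortedEntry a i| ^ 2) /
        (∑ i ∈ Icc (k - r) k, |sortedEntry a i|) ^ 2 + (#(Icc (k - r) k) : ℝ) ≤
      k / strength k a := by
  have hkp : k ≤ p := hak ▸ nnz_le a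
  have hk0 : (0 : ℝ) < k := by exact_mod_cast (by omega : 0 < k)
  have hr1 : (0 : ℝ) < r + 1 := by positivity
  have hne : {i : Fin p | a i ≠ 0}.Nonempty := by
    rw [← Set.ncard_pos (Set.toFinite _)]
    rw [nnz] at hak; omega
  have hfin : ((fun i => (a i) ^ 2) '' {i : Fin p | a i ≠ 0}).Finite := Set.toFinite _
  obtain ⟨i₀, hi₀, hmin⟩ := (hne.image fun i => (a i) ^ 2).csInf_mem hfin
  have hle : ∀ i, a i ≠ 0 → |a i₀| ≤ |a i| := by
    intro i hi
    rw [← sq_le_sq]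
    exact hmin.le.trans (csInf_le hfin.bddBelow ⟨i, hi, rfl⟩)
  have hstr : strength k a = k * |a i₀| ^ 2 := by
    rw [strength, ← hmin, sq_abs]
  set δ := |a i₀| with hδ
  have hδ0 : 0 < δ := abs_pos.2 hi₀
  have hc : ∀ i, 1 ≤ i → i ≤ k → δ ≤ |sortedEntry a i| := by
    intro i h1 h2
    have h0 := sortedEntry_ne_zero (w := a) h1 (by omega) (by omega)
    obtain ⟨j, rfl⟩ := exists_rank_eq a h1 (by omega : i ≤ p)
    rw [sortedEntry_rank] at h0 ⊢
    exact hle j h0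
  have hcard : #(Icc (k - r) k) = r + 1 := by rw [Nat.card_Icc]; omega
  set Q := ∑ i ∈ Icc 1 (k - r - 1), |sortedEntry a i| ^ 2 with hQ
  have hQ0 : 0 ≤ Q := Finset.sum_nonneg fun i _ => by positivity
  have hS : ((r : ℝ) + 1) * δ ≤ ∑ i ∈ Icc (k - r) k, |sortedEntry a i| := by
    have := Finset.card_nsmul_le_sum (Icc (k - r) k) (fun i => |sortedEntry a i|) δ fun i hi => by
      rw [Finset.mem_Icc] at hi
      exact hc i (by omega) hi.2
    rw [hcard, nsmul_eq_mul] at this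
    push_cast at this
    exact this
  have hS2 : ((r : ℝ) + 1) * δ ^ 2 ≤ ∑ i ∈ Icc (k - r) k, |sortedEntry a i| ^ 2 := by
    have := Finset.card_nsmul_le_sum (Icc (k - r) k) (fun i => |sortedEntry a i| ^ 2) (δ ^ 2)
      fun i hi => by
        rw [Finset.mem_Icc] at hi
        exact pow_le_pow_left₀ hδ0.le (hc i (by omega) hi.2) 2
    rw [hcard, nsmul_eq_mul] at this
    push_cast at this
    exact this
  have htotal : Q + ∑ i ∈ Icc (k - r) k, |sortedEntry a i| ^ 2 ≤ 1 := by
    have hdisj : Disjoint (Icc 1 (k - r - 1)) (Icc (k - r) k) := by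
      rw [Finset.disjoint_left]; intro i; simp only [Finset.mem_Icc]; omega
    rw [hQ, ← Finset.sum_union hdisj, sum_sortedEntry a (by
      intro i; simp only [Finset.mem_union, Finset.mem_Icc]; omega) fun x => |x| ^ 2]
    refine (Finset.sum_le_univ_sum_of_nonneg fun i => by positivity).trans (le_of_eq ?_)
    have := EuclideanSpace.real_norm_sq_eq a
    rw [ha] at this
    simp only [sq_abs]
    linarith
  have hfrac : ((r : ℝ) + 1) ^ 2 * Q / (∑ i ∈ Icc (k - r) k, |sortedEntry a i|) ^ 2 ≤ Q / δ ^ 2 := by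
    calc _ ≤ ((r : ℝ) + 1) ^ 2 * Q / (((r : ℝ) + 1) * δ) ^ 2 := by gcongr
      _ = Q / δ ^ 2 := by field_simp
  -- Here `Q + (r + 1) δ² ≤ ‖a‖² = 1`, and `1 / δ²` is `k` over the strength.
  have hfin : Q / δ ^ 2 + ((r : ℝ) + 1) ≤ 1 / δ ^ 2 := by
    rw [div_add' _ _ _ (by positivity)]
    gcongr
    linarith
  rw [hstr, hcard]
  push_cast
  have e : (k : ℝ) / (k * δ ^ 2) = 1 / δ ^ 2 := by field_simp
  rw [e]
  linarith

end KSupport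

theorem mainTheorem11 (p k : ℕ) (hk : 1 ≤ k) :
    (∀ (s : ℕ) (w : EuclideanSpace ℝ (Fin p)),
      k ≤ KSupport.nnz w → KSupport.nnz w ≤ s → s ≤ p →
      (∃! r : ℕ, KSupport.IsIndex k w r) ∧
      ∀ r : ℕ, KSupport.IsIndex k w r →
        KSupport.statisticalDimension w (KSupport.kSupportNorm k) ≤
          ENNReal.ofReal
            (5 / 4 * (s : ℝ) +
              2 * (((r : ℝ) + 1) ^ 2 *
                    (∑ i ∈ Finset.Icc 1 (k - r - 1), |KSupport.sortedEntry w i| ^ 2) /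
                    (∑ i ∈ Finset.Icc (k - r) s, |KSupport.sortedEntry w i|) ^ 2 +
                  ((Finset.Icc (k - r) s).card : ℝ)) *
                Real.log ((p : ℝ) / (s : ℝ)))) ∧
    (∀ a : EuclideanSpace ℝ (Fin p), a ∈ KSupport.atoms p k → KSupport.nnz a = k →
      KSupport.statisticalDimension a (KSupport.kSupportNorm k) ≤
        ENNReal.ofReal
          (5 / 4 * (k : ℝ) +
            2 * (k : ℝ) / KSupport.strength k a * Real.log ((p : ℝ) / (k : ℝ)))) := by
  refine ⟨fun s w hkw hws hsp => ⟨KSupport.existsUnique_isIndex hk (by omega) w,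
    fun r hr => KSupport.statisticalDimension_le_of_isIndex hk hkw hws hsp hr⟩, fun a ha hak => ?_⟩
  have hkp : k ≤ p := hak ▸ KSupport.nnz_le a
  obtain ⟨r, hr, -⟩ := KSupport.existsUnique_isIndex hk hkp a
  refine (KSupport.statisticalDimension_le_of_isIndex hk hak.ge hak.le hkp hr).trans
    (ENNReal.ofReal_le_ofReal ?_)
  have hk0 : (0 : ℝ) < k := by exact_mod_cast hk
  have hlog : 0 ≤ Real.log ((p : ℝ) / k) :=
    Real.log_nonneg ((one_le_div hk0).2 (by exact_mod_cast hkp))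
  rw [mul_div_assoc 2 (k : ℝ)]
  gcongr
  exact KSupport.coefficient_le_strength hr.1 ha.2 hak
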